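/- Let $P\subset\mathbb R^d$, $P'\subset\mathbb R^{d'}$ and $Q\subset\mathbb R^{e}$ be lattice polytopes (convex hulls of finitely many points of $\mathbb Z^d$, $\mathbb Z^{d'}$, $\mathbb Z^e$ respectively), and let $\pi:\mathbb R^d\to\mathbb R^e$ and $\pi':\mathbb R^{d'}\to\mathbb R^e$ be affine maps that send lattice points to lattice points and satisfy $\pi(P)=Q=\pi'(P')$. The fiber product is $$P\times_Q P'=\{(p,p')\in P\times P' : \pi(p)=\pi'(p')\}\subset\mathbb R^{d}\times\mathbb R^{d'}.$$ A unimodular triangulation of a polytope is a finite simplicial complex with union the polytope, all of whose maximal simplices are unimodular, i.e. have lattice points as vertices and every lattice point of their affine span is an integral affine combination of the vertices. It is regular if there are real heights $\omega_a$ on the lattice points $a$ of the polytope such that its nonempty faces are exactly the nonempty sets $\operatorname{conv}\{a : \omega_a=\eta(a)\}$, where $\eta$ ranges over the affine functionals with $\eta(a)\le\omega_a$ for all $a$. A minimal non-face is a set of lattice points of the polytope that is not the vertex set of a face, while every proper subset is (the empty set counting as a face). Let $T$ be a unimodular triangulation of $Q$, and let $S$ and $S'$ be unimodular triangulations of $P$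 and $P'$ that refine the pull-back subdivisions $\pi^*T$ and $\pi'^*T$; that is, every simplex of $S$ is contained in $P\cap\pi^{-1}(G)$ for some cell $G$ of $T$, and every simplex of $S'$ is contained in $P'\cap\pi'^{-1}(G)$ for some cell $G$ of $T$. Then $P\times_Q P'$ is a lattice polytope (with respect to $\mathbb Z^d\times\mathbb Z^{d'}$), and it has a unimodular triangulation $U$ such that 1. if $S$ and $S'$ are regular, then $U$ is regular; and 2. every minimal non-face of $U$ either has cardinality $2$ or has the same cardinality as some minimal non-face of $S$ or of $S'$. In particular, for $k\ge 2$, if all minimal non-faces of $S$ and $S'$ have cardinality at most $k$, then so do all minimal non-faces of $U$. -/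

import Mathlib

/-- The lattice `ℤ^d` inside `ℝ^d`: the vectors all of whose coordinates are integers. -/
def intLattice (d : ℕ) : AddSubgroup (Fin d → ℝ) :=
  ((Int.castAddHom ℝ).compLeft (Fin d)).range

section

variable {E E' F : Type*} [AddCommGroup E] [Module ℝ E] [AddCommGroup E'] [Module ℝ E']
  [AddCommGroup F] [Module ℝ F]

/-- A lattice polytope: the convex hull of finitely many lattice points. -/
def IsLatticePolytope (Λ : AddSubgroup E) (P : Set E) : Prop :=
  ∃ V : Finset E, (V : Set E) ⊆ Λ ∧ P = convexHull ℝ (V : Set E)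

/-- The finite set `s` is the vertex set of a unimodular simplex with respect to the lattice `Λ`
(more precisely, with respect to the lattice points in the affine span of `s`): its elements are
affinely independent lattice points, and every lattice point of the affine span of `s` is an
integral affine combination of elements of `s`. Equivalently, some affine isomorphism from `ℝ^k`
onto the affine span of `s` maps `ℤ^k` onto the lattice points of that span and the vertices of
the standard simplex onto `s`. -/
def IsUnimodularSimplex (Λ : AddSubgroup E) (s : Finset E) : Prop :=
  AffineIndependent ℝ ((↑) : s → E) ∧ (s : Set E) ⊆ Λ ∧
    ∀ x ∈ Λ, x ∈ affineSpan ℝ (s : Set E) →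
      ∃ c : E → ℤ, ∑ v ∈ s, c v = 1 ∧ ∑ v ∈ s, c v • v = x

/-- `K` is a unimodular triangulation of `P`: it is a finite simplicial complex that covers exactly
`P`, and all its cells (inclusion-maximal simplices) are unimodular. -/
def IsUnimodularTriangulation (Λ : AddSubgroup E) (K : Geometry.SimplicialComplex ℝ E)
    (P : Set E) : Prop :=
  K.faces.Finite ∧ K.space = P ∧ ∀ s ∈ K.facets, IsUnimodularSimplex Λ s

/-- The faces of the regular subdivision of a polytope `P` that is induced by the heights `ω` on
the lattice points of `P`; a linear functional plus a constant is recorded as one affine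
functional `η`. -/
def regularSubdivision (Λ : AddSubgroup E) (P : Set E) (ω : E → ℝ) : Set (Set E) :=
  {C | ∃ η : E →ᵃ[ℝ] ℝ, (∀ a ∈ P ∩ Λ, η a ≤ ω a) ∧
    C = convexHull ℝ {a | a ∈ P ∩ Λ ∧ ω a = η a}}

/-- A triangulation is regular if its nonempty faces are exactly the nonempty faces of the
regular subdivision induced by some heights on the lattice points. -/
def IsRegularTriangulation (Λ : AddSubgroup E) (K : Geometry.SimplicialComplex ℝ E) : Prop :=
  ∃ ω : E → ℝ, ∀ C : Set E, C.Nonempty →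
    (C ∈ regularSubdivision Λ K.space ω ↔ ∃ s ∈ K.faces, C = convexHull ℝ (s : Set E))

/-- `N` is a minimal non-face of the triangulation `K`: a nonempty finite set of lattice points of
the triangulated polytope that is not (the vertex set of) a face, while each of its nonempty
proper subsets is. (The empty set always counts as a face, but is not listed in `K.faces`.) -/
def IsMinimalNonface (Λ : AddSubgroup E) (K : Geometry.SimplicialComplex ℝ E)
    (N : Finset E) : Prop :=
  N.Nonempty ∧ (N : Set E) ⊆ K.space ∩ Λ ∧ N ∉ K.faces ∧
    ∀ M : Finset E, M ⊂ N → M.Nonempty → M ∈ K.faces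

/-- `π` restricts to a lattice-preserving projection of the polytope `P` onto the polytope `Q`:
it maps lattice points to lattice points, and it maps `P` onto `Q`. -/
def IsLatticeProjection (Λ : AddSubgroup E) (M : AddSubgroup F) (π : E →ᵃ[ℝ] F)
    (P : Set E) (Q : Set F) : Prop :=
  (∀ x ∈ Λ, π x ∈ M) ∧ π '' P = Q

/-- The cells of the pull-back subdivision of `P`: the intersections of `P` with the infinite
prisms `π⁻¹(C)` over the cells `C` of a triangulation of `π(P)`. -/
def pullBackCells (π : E →ᵃ[ℝ] F) (P : Set E) (T : Geometry.SimplicialComplex ℝ F) :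
    Set (Set E) :=
  {C | ∃ t ∈ T.facets, C = P ∩ π ⁻¹' convexHull ℝ (t : Set F)}

/-- The triangulation `K` refines the subdivision with the given cells: every simplex of `K` lies
in one of the cells. -/
def Refines (K : Geometry.SimplicialComplex ℝ E) (cells : Set (Set E)) : Prop :=
  ∀ s ∈ K.faces, ∃ C ∈ cells, convexHull ℝ (s : Set E) ⊆ C

/-- The polyhedral fiber product of `P` and `P'` over `π` and `π'`. -/
def fiberProduct (π : E →ᵃ[ℝ] F) (π' : E' →ᵃ[ℝ] F) (P : Set E) (P' : Set E') : Set (E × E') :=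
  {x | x.1 ∈ P ∧ x.2 ∈ P' ∧ π x.1 = π' x.2}

end

/-! Points of a triangulated set correspond to probability weights whose support is a face. A point
`(p, p')` of the fiber product thus carries weights `u` on `S` and `v` on `S'`, and a triangulation
of the fiber product amounts to a canonical coupling of `u` and `v`. The ambient spaces are linearly
ordered, and the coupling chosen is the monotone one, whose support is a chain in the product order.
It exists (`exists_coupling`) and is unique (`coupling_unique`), so the chains projecting to faces
of `S` and `S'` form a complex, the staircase triangulation familiar from products of simplices.

The orders are chosen so that `π` and `π'` are monotone. Since `S` and `S'` map simplicially to `T`,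
the weights `u` and `v` have the same image in `T`, and the coupling is pushed to a monotone
coupling of that image with itself, which is the diagonal one. Hence its atoms lie in the fiber
product (`staircaseComplex_space`).

Unimodularity holds because a chain coupling of integral marginals is integral
(`coupling_apply_mem`). For regularity, the sum of the given heights is perturbed by a small
multiple of `staircaseHeight`. Being a chain is a condition on pairs, so any larger minimal non-face
comes from `S` or `S'`. -/

/-! ### Finitely supported weights and their barycenters. -/

section Weights

open Finsupp

variable {α β : Type*} {E F : Type*} [AddCommGroup E] [Module ℝ E] [AddCommGroup F] [Module ℝ F]

/-- The total mass of a finitely supported real weight. -/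
noncomputable def totalMass : (α →₀ ℝ) →ₗ[ℝ] ℝ := Finsupp.linearCombination ℝ fun _ => (1 : ℝ)

/-- The barycenter `∑ w v • v` of a finitely supported real weight on a vector space. -/
noncomputable def barycenter : (E →₀ ℝ) →ₗ[ℝ] E := Finsupp.linearCombination ℝ id

theorem linearCombination_eq_sum (g : α → E) {w : α →₀ ℝ} {s : Finset α} (h : w.support ⊆ s) :
    Finsupp.linearCombination ℝ g w = ∑ i ∈ s, w i • g i := by
  rw [Finsupp.linearCombination_apply, Finsupp.sum_of_support_subset _ h]
  simp

theorem totalMass_eq_sum {w : α →₀ ℝ} {s : Finset α} (h : w.support ⊆ s) :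
    totalMass w = ∑ i ∈ s, w i := by
  simp [totalMass, linearCombination_eq_sum _ h]

theorem barycenter_eq_sum {w : E →₀ ℝ} {s : Finset E} (h : w.support ⊆ s) :
    barycenter w = ∑ i ∈ s, w i • i := by
  simp [barycenter, linearCombination_eq_sum _ h]

@[simp] theorem totalMass_single (a : α) (r : ℝ) : totalMass (single a r) = r := by
  simp [totalMass]

@[simp] theorem barycenter_single (a : E) (r : ℝ) : barycenter (single a r) = r • a := by
  simp [barycenter]

@[simp] theorem totalMass_mapDomain (f : α → β) (w : α →₀ ℝ) :
    totalMass (w.mapDomain f) = totalMass w := by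
  simp [totalMass, Finsupp.linearCombination_mapDomain, Function.comp_def]

theorem affineMap_linearCombination (f : E →ᵃ[ℝ] F) (w : E →₀ ℝ) :
    Finsupp.linearCombination ℝ f w = f.linear (barycenter w) + totalMass w • f 0 := by
  induction w using Finsupp.induction_linear with
  | zero => simp
  | add u v hu hv => simp only [map_add, hu, hv, add_smul]; abel
  | single a r =>
    simp only [linearCombination_single, barycenter_single, totalMass_single, map_smul]
    rw [← smul_add]
    congr 1
    simpa using f.map_vadd 0 a

theorem affineMap_barycenter (f : E →ᵃ[ℝ] F) {w : E →₀ ℝ} (hw : totalMass w = 1) :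
    f (barycenter w) = Finsupp.linearCombination ℝ f w := by
  rw [affineMap_linearCombination, hw, one_smul]
  simpa using f.map_vadd 0 (barycenter w)

theorem barycenter_mapDomain (f : α → F) (w : α →₀ ℝ) :
    barycenter (w.mapDomain f) = Finsupp.linearCombination ℝ f w := by
  simp [barycenter, Finsupp.linearCombination_mapDomain]

theorem barycenter_mapDomain_affineMap (f : E →ᵃ[ℝ] F) {w : E →₀ ℝ} (hw : totalMass w = 1) :
    barycenter (w.mapDomain f) = f (barycenter w) := by
  rw [barycenter_mapDomain, affineMap_barycenter f hw]

theorem fst_barycenter (w : E × F →₀ ℝ) :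
    barycenter (w.mapDomain Prod.fst) = (barycenter w).1 := by
  rw [barycenter_mapDomain, barycenter]
  change _ = LinearMap.fst ℝ E F _
  rw [Finsupp.apply_linearCombination]
  rfl

theorem snd_barycenter (w : E × F →₀ ℝ) :
    barycenter (w.mapDomain Prod.snd) = (barycenter w).2 := by
  rw [barycenter_mapDomain, barycenter]
  change _ = LinearMap.snd ℝ E F _
  rw [Finsupp.apply_linearCombination]
  rfl

theorem mapDomain_nonneg {w : α →₀ ℝ} (hw : 0 ≤ w) (f : α → β) : 0 ≤ w.mapDomain f := by
  classical
  intro b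
  rw [Finsupp.mapDomain, Finsupp.sum_apply]
  refine Finset.sum_nonneg fun a _ => ?_
  simp only [Finsupp.single_apply]
  split_ifs
  exacts [hw a, le_rfl]

/-- Nonnegative masses cannot cancel. This lets faces be pushed forward along with weights. -/
theorem support_mapDomain_of_nonneg [DecidableEq β] {w : α →₀ ℝ} (hw : 0 ≤ w) (f : α → β) :
    (w.mapDomain f).support = w.support.image f := by
  refine Finset.Subset.antisymm Finsupp.mapDomain_support fun b hb => ?_
  obtain ⟨a, ha, rfl⟩ := Finset.mem_image.1 hb
  rw [Finsupp.mem_support_iff] at ha ⊢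
  refine ne_of_gt ?_
  rw [Finsupp.mapDomain, Finsupp.sum_apply]
  refine Finset.sum_pos' (fun c _ => ?_) ⟨a, Finsupp.mem_support_iff.2 ha, ?_⟩
  · simp only [Finsupp.single_apply]
    split_ifs
    exacts [hw c, le_rfl]
  · simpa using lt_of_le_of_ne (hw a) (Ne.symm ha)

theorem support_nonempty_of_totalMass {w : α →₀ ℝ} (hw : totalMass w = 1) :
    w.support.Nonempty := by
  rw [Finsupp.support_nonempty_iff]
  rintro rfl
  simp at hw

theorem totalMass_pos {u : α →₀ ℝ} (hu : 0 ≤ u) (h : u ≠ 0) : 0 < totalMass u := by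
  rw [totalMass_eq_sum subset_rfl]
  exact Finset.sum_pos (fun a ha => lt_of_le_of_ne (hu a) (Finsupp.mem_support_iff.1 ha).symm)
    (Finsupp.support_nonempty_iff.2 h)

theorem exists_weight_of_finset (s : Finset α) (c : α → ℝ) :
    ∃ w : α →₀ ℝ, w.support ⊆ s ∧ ∀ a ∈ s, w a = c a := by
  classical
  refine ⟨Finsupp.onFinset s (fun a => if a ∈ s then c a else 0) (by grind),
    Finsupp.support_onFinset_subset, fun a ha => if_pos ha⟩

theorem mem_convexHull_finset_iff {s : Finset E} {x : E} :
    x ∈ convexHull ℝ (s : Set E) ↔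
      ∃ w : E →₀ ℝ, 0 ≤ w ∧ w.support ⊆ s ∧ totalMass w = 1 ∧ barycenter w = x := by
  rw [Finset.mem_convexHull']
  constructor
  · rintro ⟨c, h0, h1, hx⟩
    obtain ⟨w, hs, hw⟩ := exists_weight_of_finset s c
    refine ⟨w, fun a => ?_, hs, ?_, ?_⟩
    · by_cases ha : a ∈ s
      · simpa [hw a ha] using h0 a ha
      · simp [Finsupp.notMem_support_iff.1 fun h => ha (hs h)]
    · rw [totalMass_eq_sum hs, Finset.sum_congr rfl hw, h1]
    · rw [barycenter_eq_sum hs, ← hx]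
      exact Finset.sum_congr rfl fun a ha => by rw [hw a ha]
  · rintro ⟨w, h0, hs, h1, hx⟩
    exact ⟨w, fun a _ => h0 a, by rw [← totalMass_eq_sum hs, h1], by rw [← barycenter_eq_sum hs, hx]⟩

theorem exists_weight_of_mem_affineSpan {s : Finset E} {x : E}
    (hx : x ∈ affineSpan ℝ (s : Set E)) :
    ∃ w : E →₀ ℝ, w.support ⊆ s ∧ totalMass w = 1 ∧ barycenter w = x := by
  have hx' : x ∈ affineSpan ℝ ((id : E → E) '' (s : Set E)) := by simpa using hx
  obtain ⟨t, c, hts, hc, rfl⟩ := eq_affineCombination_of_mem_affineSpan_image hx'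
  obtain ⟨w, hs, hw⟩ := exists_weight_of_finset t c
  refine ⟨w, hs.trans (by exact_mod_cast hts), ?_, ?_⟩
  · rw [totalMass_eq_sum hs, Finset.sum_congr rfl hw, hc]
  · rw [barycenter_eq_sum hs, Finset.affineCombination_eq_linear_combination _ _ _ hc]
    exact Finset.sum_congr rfl fun a ha => by rw [hw a ha, id]

theorem affineIndependent_finset_iff {s : Finset E} :
    AffineIndependent ℝ ((↑) : s → E) ↔
      ∀ w : E →₀ ℝ, w.support ⊆ s → totalMass w = 0 → barycenter w = 0 → w = 0 := by
  classical
  rw [affineIndependent_iff]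
  constructor
  · intro h w hs h0 hb
    have := h Finset.univ (fun a => w a) (by
        rw [← h0, totalMass_eq_sum hs, ← Finset.sum_coe_sort s (fun a => w a)]) (by
        rw [← hb, barycenter_eq_sum hs, ← Finset.sum_coe_sort s (fun a => w a • a)])
    ext a
    by_cases ha : a ∈ s
    · exact this ⟨a, ha⟩ (Finset.mem_univ _)
    · simp [Finsupp.notMem_support_iff.1 fun h => ha (hs h)]
  · intro h t c h0 hb a ha
    obtain ⟨u, hu, huc⟩ := exists_weight_of_finset t c
    have e := h (u.mapDomain (↑)) (by
        refine Finsupp.mapDomain_support.trans fun a ha => ?_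
        obtain ⟨b, -, rfl⟩ := Finset.mem_image.1 ha
        exact b.2) (by
        rw [totalMass_mapDomain, totalMass_eq_sum hu, Finset.sum_congr rfl huc, h0]) (by
        rw [barycenter, Finsupp.linearCombination_mapDomain, linearCombination_eq_sum _ hu, ← hb]
        exact Finset.sum_congr rfl fun a ha => by rw [huc a ha]; rfl)
    have : u = 0 := Finsupp.mapDomain_injective Subtype.val_injective (by simpa using e)
    rw [← huc a ha, this]
    rfl

theorem AffineIndependent.weight_eq {s : Finset E} (h : AffineIndependent ℝ ((↑) : s → E))
    {w w' : E →₀ ℝ} (hw : w.support ⊆ s) (hw' : w'.support ⊆ s)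
    (ht : totalMass w = totalMass w') (hb : barycenter w = barycenter w') : w = w' := by
  classical
  rw [← sub_eq_zero]
  refine affineIndependent_finset_iff.1 h _ ?_ (by simp [ht]) (by simp [hb])
  exact (Finsupp.support_sub).trans (Finset.union_subset hw hw')

/-- Placing `s` at height `1` in `E × ℝ` makes it linearly independent, so a left inverse of the
combination map extends any values on `s`. -/
theorem AffineIndependent.exists_affineMap_eqOn {s : Finset E}
    (h : AffineIndependent ℝ ((↑) : s → E)) (f : E → ℝ) :
    ∃ φ : E →ᵃ[ℝ] ℝ, ∀ a ∈ s, φ a = f a := by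
  let L : (s →₀ ℝ) →ₗ[ℝ] E × ℝ :=
    (Finsupp.linearCombination ℝ fun a : s => ((a : E), (1 : ℝ)))
  have hL : LinearMap.ker L = ⊥ := by
    rw [LinearMap.ker_eq_bot']
    intro w hw
    have hs : (w.mapDomain ((↑) : s → E)).support ⊆ s := by
      classical
      refine Finsupp.mapDomain_support.trans fun a ha => ?_
      obtain ⟨b, -, rfl⟩ := Finset.mem_image.1 ha
      exact b.2
    have h1 : totalMass w = 0 := by
      have := congrArg (LinearMap.snd ℝ E ℝ) hw
      rw [Finsupp.apply_linearCombination, map_zero] at this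
      exact this
    have h2 : Finsupp.linearCombination ℝ ((↑) : s → E) w = 0 := by
      have := congrArg (LinearMap.fst ℝ E ℝ) hw
      rw [Finsupp.apply_linearCombination, map_zero] at this
      exact this
    have e := affineIndependent_finset_iff.1 h _ hs (by simpa using h1)
      (by simpa [barycenter, Finsupp.linearCombination_mapDomain] using h2)
    exact Finsupp.mapDomain_injective Subtype.val_injective (by simpa using e)
  obtain ⟨G, hG⟩ := L.exists_leftInverse_of_injective hL
  let ψ : E × ℝ →ₗ[ℝ] ℝ := (Finsupp.linearCombination ℝ fun a : s => f a) ∘ₗ G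
  refine ⟨ψ.toAffineMap.comp ((AffineMap.id ℝ E).prod (AffineMap.const ℝ E 1)), fun a ha => ?_⟩
  have : G (a, 1) = Finsupp.single ⟨a, ha⟩ 1 := by
    have := LinearMap.congr_fun hG (Finsupp.single ⟨a, ha⟩ 1)
    simpa [L] using this
  simp [ψ, this]

end Weights

/-! ### Monotone couplings of two weights. -/

section Couplings

open Finsupp

variable {α β : Type*}

/-- Möbius inversion on a finite support: at a minimal atom outside `H`, all other terms of the
cumulative sum lie in `H`. Taking `H = ⊥` gives uniqueness of couplings, and `H = ℤ` gives
integrality. -/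
theorem apply_mem_of_cumulative_mem [PartialOrder α] (H : AddSubgroup ℝ) (c : α →₀ ℝ)
    (h : ∀ a, Finsupp.linearCombination ℝ (Set.indicator (Set.Iic a) (1 : α → ℝ)) c ∈ H) (a : α) :
    c a ∈ H := by
  classical
  by_contra ha
  have hne : (c.support.filter fun a => c a ∉ H).Nonempty :=
    ⟨a, by simp only [Finset.mem_filter, Finsupp.mem_support_iff]
           exact ⟨fun h => ha (h ▸ H.zero_mem), ha⟩⟩
  obtain ⟨m, hm⟩ := Finset.exists_minimal hne
  have hm1 := (Finset.mem_filter.1 hm.prop)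
  have := h m
  rw [linearCombination_eq_sum _ subset_rfl, ← Finset.add_sum_erase _ _ hm1.1] at this
  refine hm1.2 ((H.add_mem_cancel_right (H.sum_mem fun b hb => ?_)).1 (by simpa using this))
  by_cases hbm : b ≤ m
  · rw [Set.indicator_of_mem (by simpa using hbm)]
    by_contra hbH
    have hb' := Finset.mem_erase.1 hb
    refine hb'.1 (le_antisymm hbm (hm.le_of_le ?_ hbm))
    exact Finset.mem_filter.2 ⟨hb'.2, by simpa using hbH⟩
  · rw [Set.indicator_of_notMem (by simpa using hbm)]
    simp

variable [LinearOrder α] [LinearOrder β]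

/-- A chain cannot have one point to the upper left of `x` and another to the lower right. So, on
the support, the quadrant below `x` coincides with one of the two half-planes. -/
theorem IsChain.cumulative_eq {w : α × β →₀ ℝ}
    (hc : IsChain (· ≤ ·) (w.support : Set (α × β))) (x : α × β) :
    (Finsupp.linearCombination ℝ (Set.indicator (Set.Iic x) (1 : α × β → ℝ)) w =
        Finsupp.linearCombination ℝ (Set.indicator (Set.Iic x.1) (1 : α → ℝ))
          (w.mapDomain Prod.fst)) ∨
    (Finsupp.linearCombination ℝ (Set.indicator (Set.Iic x) (1 : α × β → ℝ)) w =
        Finsupp.linearCombination ℝ (Set.indicator (Set.Iic x.2) (1 : β → ℝ))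
          (w.mapDomain Prod.snd)) := by
  classical
  simp only [Finsupp.linearCombination_mapDomain, linearCombination_eq_sum _ (subset_refl w.support)]
  by_cases h : ∀ y ∈ w.support, y.1 ≤ x.1 → y.2 ≤ x.2
  · left
    refine Finset.sum_congr rfl fun y hy => ?_
    congr 1
    have := h y hy
    simp only [Set.indicator_apply, Set.mem_Iic, Function.comp, Prod.le_def, Pi.one_apply]
    grind
  · right
    push Not at h
    obtain ⟨z, hz, hz1, hz2⟩ := h
    refine Finset.sum_congr rfl fun y hy => ?_
    congr 1
    have : y.2 ≤ x.2 → y.1 ≤ x.1 := by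
      intro hy2
      rcases hc.total hy hz with h | h
      · exact h.1.trans hz1
      · exact absurd (h.2.trans hy2) hz2.not_ge
    simp only [Set.indicator_apply, Set.mem_Iic, Function.comp, Prod.le_def, Pi.one_apply]
    grind

theorem linearCombination_mono {γ : Type*} {w : γ →₀ ℝ} (hw : 0 ≤ w) {f g : γ → ℝ} (h : f ≤ g) :
    Finsupp.linearCombination ℝ f w ≤ Finsupp.linearCombination ℝ g w := by
  simp only [linearCombination_eq_sum _ (subset_refl w.support), smul_eq_mul]
  exact Finset.sum_le_sum fun i _ => mul_le_mul_of_nonneg_left (h i) (hw i)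

theorem IsChain.cumulative_eq_min {w : α × β →₀ ℝ} (hw : 0 ≤ w)
    (hc : IsChain (· ≤ ·) (w.support : Set (α × β))) (x : α × β) :
    Finsupp.linearCombination ℝ (Set.indicator (Set.Iic x) (1 : α × β → ℝ)) w =
      min (Finsupp.linearCombination ℝ (Set.indicator (Set.Iic x.1) (1 : α → ℝ))
          (w.mapDomain Prod.fst))
        (Finsupp.linearCombination ℝ (Set.indicator (Set.Iic x.2) (1 : β → ℝ))
          (w.mapDomain Prod.snd)) := by
  have h1 : Finsupp.linearCombination ℝ (Set.indicator (Set.Iic x) (1 : α × β → ℝ)) w ≤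
      Finsupp.linearCombination ℝ (Set.indicator (Set.Iic x.1) (1 : α → ℝ))
          (w.mapDomain Prod.fst) := by
    classical
    rw [Finsupp.linearCombination_mapDomain]
    refine linearCombination_mono hw fun y => ?_
    simp only [Set.indicator_apply, Set.mem_Iic, Function.comp, Prod.le_def, Pi.one_apply]
    split_ifs <;> simp_all
  have h2 : Finsupp.linearCombination ℝ (Set.indicator (Set.Iic x) (1 : α × β → ℝ)) w ≤
      Finsupp.linearCombination ℝ (Set.indicator (Set.Iic x.2) (1 : β → ℝ))
          (w.mapDomain Prod.snd) := by
    classical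
    rw [Finsupp.linearCombination_mapDomain]
    refine linearCombination_mono hw fun y => ?_
    simp only [Set.indicator_apply, Set.mem_Iic, Function.comp, Prod.le_def, Pi.one_apply]
    split_ifs <;> simp_all
  rcases hc.cumulative_eq x with h | h
  · rw [min_eq_left (h ▸ h2), h]
  · rw [min_eq_right (h ▸ h1), h]

/-- A coupling of two weights whose support is a chain is determined by the two weights. -/
theorem coupling_unique {w w' : α × β →₀ ℝ} (hw : 0 ≤ w) (hw' : 0 ≤ w')
    (hc : IsChain (· ≤ ·) (w.support : Set (α × β)))
    (hc' : IsChain (· ≤ ·) (w'.support : Set (α × β)))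
    (h1 : w.mapDomain Prod.fst = w'.mapDomain Prod.fst)
    (h2 : w.mapDomain Prod.snd = w'.mapDomain Prod.snd) : w = w' := by
  ext x
  rw [← sub_eq_zero, ← Finsupp.sub_apply, ← AddSubgroup.mem_bot]
  refine apply_mem_of_cumulative_mem _ _ (fun y => ?_) x
  rw [AddSubgroup.mem_bot, map_sub, hc.cumulative_eq_min hw, hc'.cumulative_eq_min hw', h1, h2,
    sub_self]

theorem linearCombination_indicator_mem {γ : Type*} (H : AddSubgroup ℝ) {u : γ →₀ ℝ} (A : Set γ)
    (hu : ∀ a, u a ∈ H) :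
    Finsupp.linearCombination ℝ (Set.indicator A (1 : γ → ℝ)) u ∈ H := by
  classical
  rw [linearCombination_eq_sum _ (subset_refl u.support)]
  refine H.sum_mem fun a _ => ?_
  rw [Set.indicator_apply]
  split_ifs
  · simpa using hu a
  · simp

/-- Only the chain condition enters, so signed weights, that is affine combinations, are covered as
well. -/
theorem coupling_apply_mem (H : AddSubgroup ℝ) {w : α × β →₀ ℝ}
    (hc : IsChain (· ≤ ·) (w.support : Set (α × β)))
    (h1 : ∀ a, w.mapDomain Prod.fst a ∈ H) (h2 : ∀ b, w.mapDomain Prod.snd b ∈ H) (x : α × β) :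
    w x ∈ H := by
  classical
  refine apply_mem_of_cumulative_mem H w (fun y => ?_) x
  rcases hc.cumulative_eq y with h | h
  · exact h ▸ linearCombination_indicator_mem H _ h1
  · exact h ▸ linearCombination_indicator_mem H _ h2

/-- The northwest-corner rule, started from the top: the largest atoms of `u` and `v` are matched
with the smaller of their masses. This exhausts at least one of them, so the total number of atoms
drops. -/
theorem exists_coupling (n : ℕ) : ∀ (u : α →₀ ℝ) (v : β →₀ ℝ), 0 ≤ u → 0 ≤ v →
    totalMass u = totalMass v → u.support.card + v.support.card ≤ n →
    ∃ w : α × β →₀ ℝ, 0 ≤ w ∧ w.mapDomain Prod.fst = u ∧ w.mapDomain Prod.snd = v ∧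
      IsChain (· ≤ ·) (w.support : Set (α × β)) := by
  induction n with
  | zero =>
    intro u v _ _ _ h
    have hu : u = 0 := by
      rw [← Finsupp.card_support_eq_zero]; omega
    have hv : v = 0 := by
      rw [← Finsupp.card_support_eq_zero]; omega
    exact ⟨0, le_rfl, by simp [hu], by simp [hv], by simp⟩
  | succ n ih =>
    intro u v hu hv ht hn
    by_cases hu0 : u = 0
    · have hv0 : v = 0 := by
        by_contra h
        have := totalMass_pos hv h
        simp [← ht, hu0] at this
      exact ⟨0, le_rfl, by simp [hu0], by simp [hv0], by simp⟩
    have hv0 : v ≠ 0 := by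
      rintro rfl
      have := totalMass_pos hu hu0
      simp [ht] at this
    have hun := Finsupp.support_nonempty_iff.2 hu0
    have hvn := Finsupp.support_nonempty_iff.2 hv0
    set a := u.support.max' hun with ha
    set b := v.support.max' hvn with hb
    have ha' : a ∈ u.support := Finset.max'_mem _ _
    have hb' : b ∈ v.support := Finset.max'_mem _ _
    set m := min (u a) (v b) with hm
    have hua : 0 < u a := lt_of_le_of_ne (hu a) (Finsupp.mem_support_iff.1 ha').symm
    have hvb : 0 < v b := lt_of_le_of_ne (hv b) (Finsupp.mem_support_iff.1 hb').symm
    have hm0 : 0 < m := lt_min hua hvb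
    have hsu : (u - single a m).support ⊆ u.support := by
      intro x hx
      by_cases h : x = a
      · rwa [h]
      · simpa [Finsupp.single_apply, Ne.symm h] using hx
    have hsv : (v - single b m).support ⊆ v.support := by
      intro x hx
      by_cases h : x = b
      · rwa [h]
      · simpa [Finsupp.single_apply, Ne.symm h] using hx
    have hcard : (u - single a m).support.card + (v - single b m).support.card ≤ n := by
      have h1 := Finset.card_le_card hsu
      have h2 := Finset.card_le_card hsv
      rcases min_choice (u a) (v b) with h | h
      · have := Finset.card_lt_card (Finset.ssubset_iff_subset_ne.2 ⟨hsu, fun e => by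
          rw [← e] at ha'; simp [hm, h] at ha'⟩)
        omega
      · have := Finset.card_lt_card (Finset.ssubset_iff_subset_ne.2 ⟨hsv, fun e => by
          rw [← e] at hb'; simp [hm, h] at hb'⟩)
        omega
    obtain ⟨w, hw, hw1, hw2, hwc⟩ := ih (u - single a m) (v - single b m)
      (by
        intro x
        by_cases h : x = a
        · simp [h, hm]
        · simpa [Finsupp.single_apply, Ne.symm h] using hu x)
      (by
        intro x
        by_cases h : x = b
        · simp [h, hm]
        · simpa [Finsupp.single_apply, Ne.symm h] using hv x)
      (by simp [ht]) hcard
    refine ⟨w + single (a, b) m, add_nonneg hw (by simpa using hm0.le), ?_, ?_, ?_⟩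
    · rw [Finsupp.mapDomain_add, hw1, Finsupp.mapDomain_single, sub_add_cancel]
    · rw [Finsupp.mapDomain_add, hw2, Finsupp.mapDomain_single, sub_add_cancel]
    · have hsub : ((w + single (a, b) m).support : Set (α × β)) ⊆ insert (a, b) w.support := by
        intro x hx
        by_cases h : x = (a, b)
        · exact Or.inl h
        · right
          have h' : (a, b) ≠ x := Ne.symm h
          simpa [Finsupp.single_apply, h'] using hx
      -- Every remaining atom has coordinates in the supports of `u` and `v`, hence lies below the
      -- pair of maxima.
      refine (hwc.insert fun x hx _ => Or.inr ⟨?_, ?_⟩).mono hsub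
      · refine Finset.le_max' _ _ (hsu ?_)
        rw [← hw1, support_mapDomain_of_nonneg hw]
        exact Finset.mem_image_of_mem _ hx
      · refine Finset.le_max' _ _ (hsv ?_)
        rw [← hw2, support_mapDomain_of_nonneg hw]
        exact Finset.mem_image_of_mem _ hx

end Couplings

/-! ### Simplicial complexes through weights, unimodularity and regularity. -/

section Complexes

open Finsupp

variable {E F : Type*} [AddCommGroup E] [Module ℝ E] [AddCommGroup F] [Module ℝ F]

theorem Geometry.SimplicialComplex.weight_unique (K : Geometry.SimplicialComplex ℝ E)
    {w w' : E →₀ ℝ} (hw : 0 ≤ w) (hw' : 0 ≤ w') (hs : w.support ∈ K.faces)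
    (hs' : w'.support ∈ K.faces) (ht : totalMass w = 1) (ht' : totalMass w' = 1)
    (hb : barycenter w = barycenter w') : w = w' := by
  classical
  have h : barycenter w ∈ convexHull ℝ ((w.support ∩ w'.support : Finset E) : Set E) := by
    rw [Finset.coe_inter]
    exact K.inter_subset_convexHull hs hs'
      ⟨mem_convexHull_finset_iff.2 ⟨w, hw, subset_rfl, ht, rfl⟩,
        mem_convexHull_finset_iff.2 ⟨w', hw', subset_rfl, ht', hb.symm⟩⟩
  obtain ⟨u, -, hus, hut, hub⟩ := mem_convexHull_finset_iff.1 h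
  rw [(K.indep hs).weight_eq subset_rfl (hus.trans Finset.inter_subset_left) (by rw [ht, hut])
    hub.symm, (K.indep hs').weight_eq subset_rfl (hus.trans Finset.inter_subset_right)
    (by rw [ht', hut]) (by rw [← hb, hub])]

theorem Geometry.SimplicialComplex.exists_weight (K : Geometry.SimplicialComplex ℝ E) {x : E}
    (hx : x ∈ K.space) :
    ∃ w : E →₀ ℝ, 0 ≤ w ∧ w.support ∈ K.faces ∧ totalMass w = 1 ∧ barycenter w = x := by
  obtain ⟨s, hs, hxs⟩ := Geometry.SimplicialComplex.mem_space_iff.1 hx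
  obtain ⟨w, hw, hws, ht, hb⟩ := mem_convexHull_finset_iff.1 hxs
  exact ⟨w, hw, K.down_closed hs hws (support_nonempty_of_totalMass ht), ht, hb⟩

/-- A downward closed family of nonempty finite sets such that every point is the barycenter of
at most one probability weight supported on a member is a geometric simplicial complex. -/
def Geometry.SimplicialComplex.ofWeightUnique (faces : Set (Finset E))
    (hrel : IsRelLowerSet faces Finset.Nonempty)
    (huniq : ∀ w w' : E →₀ ℝ, 0 ≤ w → 0 ≤ w' → w.support ∈ faces → w'.support ∈ faces →
      totalMass w = 1 → totalMass w' = 1 → barycenter w = barycenter w' → w = w') :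
    Geometry.SimplicialComplex ℝ E where
  faces := faces
  isRelLowerSet_faces := hrel
  indep := by
    classical
    intro s hs
    obtain ⟨hne, hdown⟩ := hrel hs
    rw [affineIndependent_finset_iff]
    intro c hc h0 hb
    -- The uniform weight `u` is perturbed by a small multiple of the affine dependence `c`. The
    -- mass and the barycenter do not change, so uniqueness of weights forces `c = 0`.
    obtain ⟨u, hus, hu⟩ := exists_weight_of_finset s fun _ => (s.card : ℝ)⁻¹
    have hcard : 0 < (s.card : ℝ) := by exact_mod_cast hne.card_pos
    have hut : totalMass u = 1 := by
      rw [totalMass_eq_sum hus, Finset.sum_congr rfl hu]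
      simp [hcard.ne']
    obtain ⟨ε, hε, hle⟩ : ∃ ε : ℝ, 0 < ε ∧ ∀ a ∈ s, ε * |c a| ≤ (s.card : ℝ)⁻¹ := by
      have hM : 0 ≤ ∑ b ∈ s, |c b| := Finset.sum_nonneg fun _ _ => abs_nonneg _
      refine ⟨(s.card : ℝ)⁻¹ / (∑ b ∈ s, |c b| + 1), by positivity, fun a ha => ?_⟩
      have := Finset.single_le_sum (f := fun b => |c b|) (fun _ _ => abs_nonneg _) ha
      rw [div_mul_eq_mul_div, div_le_iff₀ (by positivity)]
      exact mul_le_mul_of_nonneg_left (by linarith) (by positivity)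
    have hsupp : (u + ε • c).support ⊆ s := Finsupp.support_add.trans
      (Finset.union_subset hus (Finsupp.support_smul.trans hc))
    have hzero : ∀ {w : E →₀ ℝ}, w.support ⊆ s → ∀ a ∉ s, w a = 0 := fun hw a ha =>
      Finsupp.notMem_support_iff.1 fun h => ha (hw h)
    have hnn : 0 ≤ u + ε • c := by
      intro a
      by_cases ha : a ∈ s
      · have h1 := hle a ha
        have h2 := neg_abs_le (c a)
        simp only [Finsupp.coe_zero, Pi.zero_apply, Finsupp.add_apply, Finsupp.smul_apply,
          smul_eq_mul, hu a ha]
        nlinarith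
      · exact (hzero hsupp a ha).ge
    have hunn : 0 ≤ u := by
      intro a
      by_cases ha : a ∈ s
      · simp only [Finsupp.coe_zero, Pi.zero_apply, hu a ha]
        positivity
      · exact (hzero hus a ha).ge
    have ht : totalMass (u + ε • c) = 1 := by simp [hut, h0]
    have e := huniq _ _ hnn hunn (hdown hsupp (support_nonempty_of_totalMass ht))
      (hdown hus (support_nonempty_of_totalMass hut)) ht hut (by simp [hb])
    simpa [hε.ne'] using e
  inter_subset_convexHull := by
    classical
    rintro s t hs ht x ⟨hxs, hxt⟩
    obtain ⟨u, hu, hus, hut, hub⟩ := mem_convexHull_finset_iff.1 hxs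
    obtain ⟨v, hv, hvs, hvt, hvb⟩ := mem_convexHull_finset_iff.1 hxt
    have e := huniq u v hu hv ((hrel hs).2 hus (support_nonempty_of_totalMass hut))
      ((hrel ht).2 hvs (support_nonempty_of_totalMass hvt)) hut hvt (hub.trans hvb.symm)
    rw [← Finset.coe_inter]
    exact mem_convexHull_finset_iff.2 ⟨u, hu, Finset.subset_inter hus (e ▸ hvs), hut, hub⟩

variable {Λ : AddSubgroup E} {K : Geometry.SimplicialComplex ℝ E} {P : Set E}

/-- Affine independence identifies `w` with the integral combination that unimodularity provides. -/
theorem IsUnimodularSimplex.exists_int_weight {s : Finset E} (h : IsUnimodularSimplex Λ s)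
    {w : E →₀ ℝ} (hs : w.support ⊆ s) (ht : totalMass w = 1) (hb : barycenter w ∈ Λ) :
    ∃ c : E → ℤ, ∀ a ∈ s, w a = c a := by
  have hmem : barycenter w ∈ affineSpan ℝ (s : Set E) := by
    rw [totalMass_eq_sum hs] at ht
    rw [barycenter_eq_sum hs, ← Finset.affineCombination_eq_linear_combination s (fun a => a) _ ht]
    have := affineCombination_mem_affineSpan_image ht (s := s) (s' := s)
      (fun i hi h => (h hi).elim) (fun a : E => a)
    simpa using this
  obtain ⟨c, hc1, hcx⟩ := h.2.2 _ hb hmem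
  obtain ⟨u, hus, hu⟩ := exists_weight_of_finset s fun a => (c a : ℝ)
  have e : w = u := h.1.weight_eq hs hus
    (by rw [ht, totalMass_eq_sum hus, Finset.sum_congr rfl hu]; exact_mod_cast hc1.symm)
    (by
      rw [← hcx, barycenter_eq_sum hus]
      exact Finset.sum_congr rfl fun a ha => by rw [hu a ha, Int.cast_smul_eq_zsmul])
  exact ⟨c, fun a ha => by rw [e, hu a ha]⟩

theorem IsUnimodularSimplex.mono {s t : Finset E} (h : IsUnimodularSimplex Λ s) (hts : t ⊆ s) :
    IsUnimodularSimplex Λ t := by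
  refine ⟨h.1.mono (by exact_mod_cast hts), fun x hx => h.2.1 (hts hx), fun x hxΛ hx => ?_⟩
  obtain ⟨w, hwt, ht, rfl⟩ := exists_weight_of_mem_affineSpan hx
  obtain ⟨c, hc⟩ := h.exists_int_weight (hwt.trans hts) ht hxΛ
  refine ⟨c, ?_, ?_⟩
  · rw [totalMass_eq_sum hwt, Finset.sum_congr rfl fun a ha => hc a (hts ha)] at ht
    exact_mod_cast ht
  · rw [barycenter_eq_sum hwt]
    exact Finset.sum_congr rfl fun a ha => by rw [hc a (hts ha), Int.cast_smul_eq_zsmul]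

/-- The only lattice points of a unimodular simplex are its vertices. -/
theorem IsUnimodularSimplex.mem_of_mem_convexHull {s : Finset E} (h : IsUnimodularSimplex Λ s)
    {x : E} (hxΛ : x ∈ Λ) (hx : x ∈ convexHull ℝ (s : Set E)) : x ∈ s := by
  obtain ⟨w, hw, hws, ht, rfl⟩ := mem_convexHull_finset_iff.1 hx
  obtain ⟨c, hc⟩ := h.exists_int_weight hws ht hxΛ
  obtain ⟨a, ha⟩ := support_nonempty_of_totalMass ht
  have has := hws ha
  have hle : w a ≤ 1 := by
    rw [← ht, totalMass_eq_sum hws]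
    exact Finset.single_le_sum (fun b _ => hw b) has
  have hpos : 0 < w a := lt_of_le_of_ne (hw a) (Finsupp.mem_support_iff.1 ha).symm
  have h1 : w a = 1 := by
    rw [hc a has] at hle hpos ⊢
    norm_cast at hle hpos ⊢
    omega
  have hnn : 0 ≤ w - single a 1 := by
    classical
    intro b
    by_cases hb : a = b
    · subst hb; simp [h1]
    · simpa [Finsupp.single_apply, hb] using hw b
  have : w = single a 1 := by
    by_contra hne
    have := totalMass_pos hnn (sub_ne_zero.2 hne)
    simp [ht] at this
  rw [this]
  simpa using has

theorem Geometry.SimplicialComplex.exists_facet_superset (hfin : K.faces.Finite) {s : Finset E}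
    (hs : s ∈ K.faces) : ∃ t ∈ K.facets, s ⊆ t := by
  obtain ⟨t, hst, ht⟩ := hfin.exists_le_maximal hs
  exact ⟨t, ⟨ht.prop, fun u hu htu => le_antisymm htu (ht.le_of_ge hu htu)⟩, hst⟩

theorem IsUnimodularTriangulation.isUnimodularSimplex (h : IsUnimodularTriangulation Λ K P)
    {s : Finset E} (hs : s ∈ K.faces) : IsUnimodularSimplex Λ s := by
  obtain ⟨t, ht, hst⟩ := Geometry.SimplicialComplex.exists_facet_superset h.1 hs
  exact (h.2.2 t ht).mono hst

theorem IsUnimodularTriangulation.singleton_mem (h : IsUnimodularTriangulation Λ K P)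
    {x : E} (hx : x ∈ K.space) (hxΛ : x ∈ Λ) : {x} ∈ K.faces := by
  obtain ⟨s, hs, hxs⟩ := Geometry.SimplicialComplex.mem_space_iff.1 hx
  exact K.down_closed hs (by
    simpa using (h.isUnimodularSimplex hs).mem_of_mem_convexHull hxΛ hxs) (by simp)

/-- Regularity is passed from convex hulls to vertices. Contact points lie in `s` because a
unimodular simplex has no further lattice points; conversely, by affine independence a vertex in the
hull of the contact points is one of them. -/
theorem IsRegularTriangulation.exists_heights (h : IsUnimodularTriangulation Λ K P)
    (hreg : IsRegularTriangulation Λ K) :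
    ∃ ω : E → ℝ, ∀ s ∈ K.faces, ∃ η : E →ᵃ[ℝ] ℝ, (∀ a ∈ K.space ∩ Λ, η a ≤ ω a) ∧
      ∀ a ∈ K.space ∩ Λ, ω a = η a ↔ a ∈ s := by
  classical
  obtain ⟨ω, hω⟩ := hreg
  refine ⟨ω, fun s hs => ?_⟩
  have hsu := h.isUnimodularSimplex hs
  obtain ⟨η, hη, hC⟩ := (hω (convexHull ℝ (s : Set E))
    (by simpa using K.nonempty_of_mem_faces hs)).2 ⟨s, hs, rfl⟩
  have hsub : {a | a ∈ K.space ∩ Λ ∧ ω a = η a} ⊆ (s : Set E) := fun a ha =>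
    hsu.mem_of_mem_convexHull ha.1.2 (hC ▸ subset_convexHull ℝ _ ha)
  refine ⟨η, hη, fun a ha => ⟨fun h => hsub ⟨ha, h⟩, fun has => ?_⟩⟩
  obtain ⟨t, ht⟩ : ∃ t : Finset E, (t : Set E) = {a | a ∈ K.space ∩ Λ ∧ ω a = η a} :=
    ⟨(s.finite_toSet.subset hsub).toFinset, by simp⟩
  have hat : a ∈ convexHull ℝ (t : Set E) := by
    rw [ht, ← hC]
    exact subset_convexHull ℝ _ has
  obtain ⟨w, -, hwt, hw1, hwb⟩ := mem_convexHull_finset_iff.1 hat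
  have hts : t ⊆ s := fun b hb => hsub (ht ▸ (by exact_mod_cast hb))
  have e : w = single a 1 := hsu.1.weight_eq (hwt.trans hts)
    (Finsupp.support_single_subset.trans (by simpa using has)) (by simp [hw1]) (by simp [hwb])
  have : a ∈ (t : Set E) := by
    have := @hwt a (by simp [e])
    exact_mod_cast this
  rw [ht] at this
  exact this.2

/-- It remains to see that every nonempty contact set `t` is a face. Let `x` be the centroid of `t`,
let `w` be the weight of `x` on a face, and let `ζ` support that face. Then `η x ≤ ∑ w ω = ζ x ≤ ∑ u
ω = η x`. Equality throughout holds termwise, so `t` and the support of `w` contain each other. -/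
theorem IsRegularTriangulation.of_heights (hΛ : ∀ s ∈ K.faces, (s : Set E) ⊆ Λ)
    (hfin : (K.space ∩ Λ).Finite) (hconv : Convex ℝ K.space) {ω : E → ℝ}
    (hω : ∀ s ∈ K.faces, ∃ η : E →ᵃ[ℝ] ℝ, (∀ a ∈ K.space ∩ Λ, η a ≤ ω a) ∧
      ∀ a ∈ K.space ∩ Λ, ω a = η a ↔ a ∈ s) :
    IsRegularTriangulation Λ K := by
  classical
  refine ⟨ω, fun C hC => ⟨?_, ?_⟩⟩
  · rintro ⟨η, hη, rfl⟩
    obtain ⟨t, ht⟩ : ∃ t : Finset E, (t : Set E) = {a | a ∈ K.space ∩ Λ ∧ ω a = η a} :=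
      ⟨(hfin.subset fun a (ha : a ∈ {a | a ∈ K.space ∩ Λ ∧ ω a = η a}) => ha.1).toFinset, by simp⟩
    have hmem : ∀ a, a ∈ t ↔ a ∈ K.space ∩ Λ ∧ ω a = η a := fun a => by
      rw [← Finset.mem_coe, ht]; rfl
    rw [← ht] at hC ⊢
    have hne : t.Nonempty := by simpa using hC
    obtain ⟨u, hut, hu⟩ := exists_weight_of_finset t fun _ => (t.card : ℝ)⁻¹
    have hcard : 0 < (t.card : ℝ) := by exact_mod_cast hne.card_pos
    have hu1 : totalMass u = 1 := by
      rw [totalMass_eq_sum hut, Finset.sum_congr rfl hu]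
      simp [hcard.ne']
    have hunn : 0 ≤ u := by
      intro a
      by_cases ha : a ∈ t
      · simp only [Finsupp.coe_zero, Pi.zero_apply, hu a ha]
        positivity
      · exact (Finsupp.notMem_support_iff.1 fun h => ha (hut h)).ge
    have hspace : barycenter u ∈ K.space :=
      convexHull_min (fun a ha => ((hmem a).1 (by exact_mod_cast ha)).1.1) hconv
        (mem_convexHull_finset_iff.2 ⟨u, hunn, hut, hu1, rfl⟩)
    obtain ⟨w, hw, hws, hw1, hwb⟩ := K.exists_weight hspace
    obtain ⟨ζ, hζ, hζs⟩ := hω _ hws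
    have hsupp : ∀ v ∈ w.support, v ∈ K.space ∩ Λ := fun v hv =>
      ⟨K.subset_space hws hv, hΛ _ hws hv⟩
    have hwζ : Finsupp.linearCombination ℝ ω w = ζ (barycenter w) := by
      rw [affineMap_barycenter _ hw1, linearCombination_eq_sum _ subset_rfl,
        linearCombination_eq_sum _ subset_rfl]
      exact Finset.sum_congr rfl fun v hv => by rw [(hζs v (hsupp v hv)).2 hv]
    have huη : Finsupp.linearCombination ℝ ω u = η (barycenter u) := by
      rw [affineMap_barycenter _ hu1, linearCombination_eq_sum _ hut,
        linearCombination_eq_sum _ hut]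
      exact Finset.sum_congr rfl fun v hv => by rw [((hmem v).1 hv).2]
    have hle1 : ∀ v ∈ w.support, w v • η v ≤ w v • ω v := fun v hv =>
      mul_le_mul_of_nonneg_left (hη v (hsupp v hv)) (hw v)
    have hle2 : ∀ v ∈ t, u v • ζ v ≤ u v • ω v := fun v hv =>
      mul_le_mul_of_nonneg_left (hζ v ((hmem v).1 hv).1) (hunn v)
    have h1 : η (barycenter w) ≤ Finsupp.linearCombination ℝ ω w := by
      rw [affineMap_barycenter _ hw1, linearCombination_eq_sum _ subset_rfl,
        linearCombination_eq_sum _ subset_rfl]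
      exact Finset.sum_le_sum hle1
    have h2 : ζ (barycenter u) ≤ Finsupp.linearCombination ℝ ω u := by
      rw [affineMap_barycenter _ hu1, linearCombination_eq_sum _ hut,
        linearCombination_eq_sum _ hut]
      exact Finset.sum_le_sum hle2
    have e1 : η (barycenter w) = Finsupp.linearCombination ℝ ω w := by
      rw [hwb] at *; linarith
    have e2 : ζ (barycenter u) = Finsupp.linearCombination ℝ ω u := by
      rw [hwb] at *; linarith
    rw [affineMap_barycenter _ hw1, linearCombination_eq_sum _ subset_rfl,
      linearCombination_eq_sum _ subset_rfl, Finset.sum_eq_sum_iff_of_le hle1] at e1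
    rw [affineMap_barycenter _ hu1, linearCombination_eq_sum _ hut,
      linearCombination_eq_sum _ hut, Finset.sum_eq_sum_iff_of_le hle2] at e2
    refine ⟨w.support, hws, ?_⟩
    suffices t = w.support by rw [this]
    refine Finset.Subset.antisymm (fun a ha => ?_) fun a ha => ?_
    · have h := e2 a ha
      rw [hu a ha] at h
      have h' : ζ a = ω a := by simpa [hcard.ne'] using h
      exact (hζs a ((hmem a).1 ha).1).1 h'.symm
    · have h := e1 a ha
      have h' : η a = ω a := mul_left_cancel₀ (Finsupp.mem_support_iff.1 ha) h
      exact (hmem a).2 ⟨hsupp a ha, h'.symm⟩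
  · rintro ⟨s, hs, rfl⟩
    obtain ⟨η, hη, hηs⟩ := hω s hs
    refine ⟨η, hη, congrArg _ (Set.ext fun a => ⟨fun ha => ?_, fun ha => ?_⟩)⟩
    · have : a ∈ K.space ∩ Λ := ⟨K.subset_space hs ha, hΛ s hs ha⟩
      exact ⟨this, (hηs a this).2 ha⟩
    · exact (hηs a ha.1).1 ha.2

theorem isLatticePolytope_of_triangulation (h : IsUnimodularTriangulation Λ K P)
    (hconv : Convex ℝ P) : IsLatticePolytope Λ P := by
  classical
  have hs := h.2.1
  refine ⟨h.1.toFinset.biUnion id, ?_, ?_⟩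
  · intro a ha
    simp only [Finset.coe_biUnion, id, Set.mem_iUnion] at ha
    obtain ⟨s, hs, ha⟩ := ha
    exact (h.isUnimodularSimplex (by simpa using hs)).2.1 ha
  · refine Set.Subset.antisymm (fun x hx => ?_) (convexHull_min (fun a ha => ?_) hconv)
    · rw [← hs] at hx
      obtain ⟨s, hs, hxs⟩ := Geometry.SimplicialComplex.mem_space_iff.1 hx
      refine convexHull_mono (fun a ha => ?_) hxs
      simp only [Finset.coe_biUnion, id, Set.mem_iUnion]
      exact ⟨s, by simpa using hs, ha⟩
    · simp only [Finset.coe_biUnion, id, Set.mem_iUnion] at ha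
      obtain ⟨s, hsK, ha⟩ := ha
      rw [← hs]
      exact K.subset_space (by simpa using hsK) ha

end Complexes

/-! ### Heights that select the chains in a product. -/

section Staircase

variable {α β : Type*} [LinearOrder α] [LinearOrder β]

/-- The staircase heights with respect to finite sets of thresholds: a point is lowered by the
number of pairs of thresholds that lie below it. -/
noncomputable def staircaseHeight (V : Finset α) (V' : Finset β) (x : α × β) : ℝ :=
  ∑ c ∈ V ×ˢ V', -((Set.Ici c.1).indicator 1 x.1 * (Set.Ici c.2).indicator 1 x.2)

/-- For one threshold `c` the height is `-1` on the quadrant above `c` and `0` elsewhere. The drop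
is split as `r` on the first coordinate and `1 - r` on the second, which always stays below the
height. -/
theorem IsChain.exists_threshold_potentials {N : Set (α × β)} (hN : IsChain (· ≤ ·) N)
    (c : α × β) :
    ∃ (f : α → ℝ) (g : β → ℝ),
      (∀ x : α × β, f x.1 + g x.2 ≤
        -((Set.Ici c.1).indicator 1 x.1 * (Set.Ici c.2).indicator 1 x.2)) ∧
      (∀ x ∈ N, f x.1 + g x.2 =
        -((Set.Ici c.1).indicator 1 x.1 * (Set.Ici c.2).indicator 1 x.2)) ∧
      (∀ x : α × β, x.1 < c.1 → c.2 ≤ x.2 → (∀ y ∈ N, c.2 ≤ y.2 → c.1 ≤ y.1) → f x.1 + g x.2 <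
        -((Set.Ici c.1).indicator 1 x.1 * (Set.Ici c.2).indicator 1 x.2)) ∧
      (∀ x : α × β, c.1 ≤ x.1 → x.2 < c.2 → (∀ y ∈ N, c.1 ≤ y.1 → c.2 ≤ y.2) → f x.1 + g x.2 <
        -((Set.Ici c.1).indicator 1 x.1 * (Set.Ici c.2).indicator 1 x.2)) := by
  classical
  have hpq : (∀ y ∈ N, c.2 ≤ y.2 → c.1 ≤ y.1) ∨ (∀ y ∈ N, c.1 ≤ y.1 → c.2 ≤ y.2) := by
    by_contra! h
    obtain ⟨⟨y, hy, hy2, hy1⟩, z, hz, hz1, hz2⟩ := h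
    rcases hN.total hy hz with h | h
    · exact absurd (hy2.trans h.2) hz2.not_ge
    · exact absurd (hz1.trans h.1) hy1.not_ge
  -- Tightness on `N` needs `r = 1` if `N` has a point above `c` in the second coordinate only, and
  -- `r = 0` if in the first only; a chain cannot have both. If it has neither, `r = 1 / 2` is
  -- strict on both sides.
  obtain ⟨r, hr0, hr1, h1, h2, h3, h4⟩ : ∃ r : ℝ, 0 ≤ r ∧ r ≤ 1 ∧
      ((∀ y ∈ N, c.2 ≤ y.2 → c.1 ≤ y.1) → r < 1) ∧
      ((∀ y ∈ N, c.1 ≤ y.1 → c.2 ≤ y.2) → 0 < r) ∧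
      (¬(∀ y ∈ N, c.2 ≤ y.2 → c.1 ≤ y.1) → r = 1) ∧
      (¬(∀ y ∈ N, c.1 ≤ y.1 → c.2 ≤ y.2) → r = 0) := by
    by_cases hp : ∀ y ∈ N, c.2 ≤ y.2 → c.1 ≤ y.1
    · by_cases hq : ∀ y ∈ N, c.1 ≤ y.1 → c.2 ≤ y.2
      · exact ⟨1 / 2, by norm_num, by norm_num, fun _ => by norm_num, fun _ => by norm_num,
          fun h => absurd hp h, fun h => absurd hq h⟩
      · exact ⟨0, by norm_num, by norm_num, fun _ => by norm_num, fun h => absurd h hq,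
          fun h => absurd hp h, fun _ => rfl⟩
    · have hq := hpq.resolve_left hp
      exact ⟨1, by norm_num, by norm_num, fun h => absurd h hp, fun _ => by norm_num,
        fun _ => rfl, fun h => absurd hq h⟩
  refine ⟨fun a => -r * (Set.Ici c.1).indicator 1 a,
    fun b => -(1 - r) * (Set.Ici c.2).indicator 1 b, fun x => ?_, fun x hx => ?_,
    fun x hx1 hx2 h => ?_, fun x hx1 hx2 h => ?_⟩
  · by_cases hx1 : c.1 ≤ x.1 <;> by_cases hx2 : c.2 ≤ x.2 <;>
      simp [hx1, hx2] <;> linarith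
  · by_cases hx1 : c.1 ≤ x.1 <;> by_cases hx2 : c.2 ≤ x.2
    · simp [hx1, hx2]
      ring
    · simpa [Set.indicator_apply, hx1, hx2] using h4 fun h => hx2 (h x hx hx1)
    · have := h3 fun h => hx1 (h x hx hx2)
      simp [hx1, hx2, this]
    · simp [hx1, hx2]
  · have := h1 h
    simp [hx1.not_ge, hx2, this]
  · have := h2 h
    simp [hx2.not_ge, hx1, this]

theorem IsChain.exists_staircase_potentials {N : Finset (α × β)}
    (hN : IsChain (· ≤ ·) (N : Set (α × β))) {V : Finset α} {V' : Finset β}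
    (hV : ∀ x ∈ N, x.1 ∈ V) (hV' : ∀ x ∈ N, x.2 ∈ V') :
    ∃ (f : α → ℝ) (g : β → ℝ),
      (∀ x ∈ N, f x.1 + g x.2 = staircaseHeight V V' x) ∧
      ∀ x : α × β, x.1 ∈ N.image Prod.fst → x.2 ∈ N.image Prod.snd → x ∉ N →
        f x.1 + g x.2 < staircaseHeight V V' x := by
  classical
  choose f g hle heq hlt1 hlt2 using hN.exists_threshold_potentials
  refine ⟨fun a => ∑ c ∈ V ×ˢ V', f c a, fun b => ∑ c ∈ V ×ˢ V', g c b, fun x hx => ?_,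
    fun x hx1 hx2 hxN => ?_⟩
  · rw [← Finset.sum_add_distrib]
    exact Finset.sum_congr rfl fun c _ => heq c x hx
  · rw [← Finset.sum_add_distrib]
    refine Finset.sum_lt_sum (fun c _ => hle c x) ?_
    have hne1 : (N.filter fun y => y.2 = x.2).Nonempty := by
      obtain ⟨y, hy, e⟩ := Finset.mem_image.1 hx2
      exact ⟨y, Finset.mem_filter.2 ⟨hy, e⟩⟩
    -- Let `y` be the first point of `N` in the row of `x`, and `z` the lowest in its column. If `x`
    -- is left of `y` or below `z`, that point is a strict threshold. Otherwise `y` and `z` would be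
    -- incomparable.
    obtain ⟨y, hy, hymin⟩ := Finset.exists_min_image _ Prod.fst hne1
    obtain ⟨hyN, hy2⟩ := Finset.mem_filter.1 hy
    have hne2 : (N.filter fun y => y.1 = x.1).Nonempty := by
      obtain ⟨y, hy, e⟩ := Finset.mem_image.1 hx1
      exact ⟨y, Finset.mem_filter.2 ⟨hy, e⟩⟩
    obtain ⟨z, hz, hzmin⟩ := Finset.exists_min_image _ Prod.snd hne2
    obtain ⟨hzN, hz1⟩ := Finset.mem_filter.1 hz
    rcases lt_trichotomy x.1 y.1 with h | h | h
    · refine ⟨y, Finset.mk_mem_product (hV y hyN) (hV' y hyN), hlt1 y x h hy2.le ?_⟩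
      intro u hu hyu
      rcases hN.total hu hyN with h' | h'
      · exact hymin u (Finset.mem_filter.2 ⟨hu, (h'.2.antisymm hyu).trans hy2⟩)
      · exact h'.1
    · exact absurd (Prod.ext h hy2.symm ▸ hyN) hxN
    · rcases lt_trichotomy x.2 z.2 with h' | h' | h'
      · refine ⟨z, Finset.mk_mem_product (hV z hzN) (hV' z hzN), hlt2 z x hz1.le h' ?_⟩
        intro u hu hzu
        rcases hN.total hu hzN with h'' | h''
        · exact hzmin u (Finset.mem_filter.2 ⟨hu, (h''.1.antisymm hzu).trans hz1⟩)
        · exact h''.2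
      · exact absurd (Prod.ext hz1.symm h' ▸ hzN) hxN
      · exfalso
        rcases hN.total hyN hzN with h'' | h''
        · exact absurd h''.2 (by rw [hy2]; exact h'.not_ge)
        · exact absurd h''.1 (by rw [hz1]; exact h.not_ge)

end Staircase

/-! ### The staircase triangulation of the fiber product. -/

section FiberProduct

open Finsupp

open Geometry

variable {E E' F : Type*} [AddCommGroup E] [Module ℝ E] [AddCommGroup E'] [Module ℝ E']
  [AddCommGroup F] [Module ℝ F]

theorem IsUnimodularTriangulation.finite_latticePoints {Λ : AddSubgroup E}
    {K : SimplicialComplex ℝ E} {P : Set E} (h : IsUnimodularTriangulation Λ K P) :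
    (K.space ∩ Λ).Finite :=
  (h.1.preimage Finset.singleton_injective.injOn).subset fun _ hx => h.singleton_mem hx.1 hx.2

/-- Heights that support every face lexicographically can be combined to heights that do so. -/
theorem IsRegularTriangulation.of_lex_heights {Λ : AddSubgroup E}
    {K : SimplicialComplex ℝ E} {P : Set E} (h : IsUnimodularTriangulation Λ K P)
    (hconv : Convex ℝ P) {ω θ : E → ℝ}
    (hω : ∀ s ∈ K.faces, ∃ η ζ : E →ᵃ[ℝ] ℝ, ∀ a ∈ K.space ∩ Λ,
      (a ∈ s → η a = ω a ∧ ζ a = θ a) ∧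
      (a ∉ s → η a < ω a ∨ η a = ω a ∧ ζ a < θ a)) :
    IsRegularTriangulation Λ K := by
  choose! η ζ hηζ using hω
  have hfin := h.finite_latticePoints
  -- There are finitely many strict inequalities: those strict in `ω` persist for small `ε` by
  -- continuity, and ties are broken by `θ` for every `ε > 0`.
  have hev : ∀ᶠ ε : ℝ in nhdsWithin 0 (Set.Ioi 0), ∀ s ∈ K.faces, ∀ a ∈ K.space ∩ Λ, a ∉ s →
      η s a + ε * ζ s a < ω a + ε * θ a := by
    rw [Filter.eventually_all_finite h.1]
    intro s hs
    rw [Filter.eventually_all_finite hfin]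
    intro a ha
    rw [Filter.eventually_all]
    intro has
    rcases (hηζ s hs a ha).2 has with hlt | ⟨heq, hlt⟩
    · have hcont : Continuous fun ε : ℝ => (ω a + ε * θ a) - (η s a + ε * ζ s a) := by fun_prop
      have ht := (hcont.tendsto 0).eventually (lt_mem_nhds (show (0 : ℝ) <
        (ω a + 0 * θ a) - (η s a + 0 * ζ s a) by linarith))
      filter_upwards [nhdsWithin_le_nhds ht] with ε hε
      linarith
    · filter_upwards [self_mem_nhdsWithin] with ε hε
      rw [heq]
      have := mul_lt_mul_of_pos_left hlt hε
      linarith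
  obtain ⟨ε, hε⟩ := hev.exists
  refine .of_heights (fun s hs => (h.isUnimodularSimplex hs).2.1) hfin (h.2.1 ▸ hconv)
    (ω := fun a => ω a + ε * θ a) fun s hs => ⟨η s + ε • ζ s, fun a ha => ?_, fun a ha => ?_⟩
  · by_cases has : a ∈ s
    · obtain ⟨h1, h2⟩ := (hηζ s hs a ha).1 has
      simp [h1, h2]
    · simpa using (hε s hs a ha has).le
  · refine ⟨fun e => ?_, fun has => ?_⟩
    · by_contra has
      have := hε s hs a ha has
      simp at e
      linarith
    · obtain ⟨h1, h2⟩ := (hηζ s hs a ha).1 has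
      simp [h1, h2]

theorem convex_fiberProduct (π : E →ᵃ[ℝ] F) (π' : E' →ᵃ[ℝ] F) {P : Set E} {P' : Set E'}
    (hP : Convex ℝ P) (hP' : Convex ℝ P') : Convex ℝ (fiberProduct π π' P P') := by
  rintro x ⟨hx, hx', hxx⟩ y ⟨hy, hy', hyy⟩ a b ha hb hab
  refine ⟨hP hx hy ha hb hab, hP' hx' hy' ha hb hab, ?_⟩
  change π (a • x.1 + b • y.1) = π' (a • x.2 + b • y.2)
  rw [Convex.combo_affine_apply hab, Convex.combo_affine_apply hab, hxx, hyy]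

/-- A triangulation that refines the pull-back of a unimodular triangulation maps simplicially. -/
theorem Refines.image_mem_faces [DecidableEq F] {Λ : AddSubgroup E} {M : AddSubgroup F}
    {π : E →ᵃ[ℝ] F} {P : Set E} {Q : Set F} {S : SimplicialComplex ℝ E}
    {T : SimplicialComplex ℝ F} (hST : Refines S (pullBackCells π P T))
    (hπ : IsLatticeProjection Λ M π P Q)
    (hS : IsUnimodularTriangulation Λ S P) (hT : IsUnimodularTriangulation M T Q)
    {s : Finset E} (hs : s ∈ S.faces) : s.image π ∈ T.faces := by
  obtain ⟨C, ⟨t, ht, rfl⟩, hsC⟩ := hST s hs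
  refine T.down_closed ht.1 (fun b hb => ?_) ((S.nonempty_of_mem_faces hs).image _)
  obtain ⟨a, ha, rfl⟩ := Finset.mem_image.1 hb
  exact (hT.2.2 t ht).mem_of_mem_convexHull (hπ.1 a ((hS.isUnimodularSimplex hs).2.1 ha))
    (hsC (subset_convexHull ℝ _ ha)).2

theorem exists_minimalNonface_subset {S : SimplicialComplex ℝ E} {Λ : AddSubgroup E} {s : Finset E} (hne : s.Nonempty)
    (hs : (s : Set E) ⊆ S.space ∩ Λ) (hsS : s ∉ S.faces) :
    ∃ M ⊆ s, IsMinimalNonface Λ S M := by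
  classical
  obtain ⟨M, hM⟩ := Finset.exists_minimal
    (s := s.powerset.filter fun M => M.Nonempty ∧ M ∉ S.faces) ⟨s, by simp [hne, hsS]⟩
  have hp := hM.prop
  simp only [Finset.mem_filter, Finset.mem_powerset] at hp
  refine ⟨M, hp.1, hp.2.1, fun x hx => hs (hp.1 hx), hp.2.2, fun L hL hLne => ?_⟩
  by_contra h
  exact hL.2 (hM.le_of_le (by simp [hL.1.trans hp.1, hLne, h]) hL.1)

/-- A minimal non-face inside the image lifts to some `L ⊆ N` on which `f` is injective. A proper
`L` would be a face with non-face image, so `L = N` and no cardinality is lost. -/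
theorem exists_minimalNonface_card_of_image {G : Type*} [AddCommGroup G] [Module ℝ G]
    [DecidableEq E] {S : SimplicialComplex ℝ E} {Λ : AddSubgroup E} {U : SimplicialComplex ℝ G} {Γ : AddSubgroup G} {N : Finset G}
    (hN : IsMinimalNonface Γ U N) (f : G → E)
    (hf : ∀ s ∈ U.faces, s.image f ∈ S.faces) (hfN : ∀ x ∈ N, f x ∈ S.space ∩ Λ)
    (h : N.image f ∉ S.faces) : ∃ M : Finset E, IsMinimalNonface Λ S M ∧ M.card = N.card := by
  obtain ⟨M, hMs, hM⟩ := exists_minimalNonface_subset (Λ := Λ) (hN.1.image f)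
    (fun x hx => by
      obtain ⟨y, hy, rfl⟩ := Finset.mem_image.1 hx
      exact hfN y hy) h
  obtain ⟨L, hLN, hinj, rfl⟩ := Finset.exists_subset_injOn_image_eq_of_surjOn N M (f := f)
    (fun x hx => by simpa using hMs hx)
  refine ⟨L.image f, hM, ?_⟩
  have : L = N := by
    by_contra hne
    have hL := hN.2.2.2 L (Finset.ssubset_iff_subset_ne.2 ⟨by exact_mod_cast hLN, hne⟩)
      (by simpa using hM.1)
    exact hM.2.2.1 (hf L hL)
  rw [Finset.card_image_of_injOn hinj, this]

variable [LinearOrder E] [LinearOrder E']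

/-- The faces of the staircase triangulation of a fiber product. -/
def staircaseFaces (π : E →ᵃ[ℝ] F) (π' : E' →ᵃ[ℝ] F) (S : SimplicialComplex ℝ E)
    (S' : SimplicialComplex ℝ E') : Set (Finset (E × E')) :=
  {N | N.image Prod.fst ∈ S.faces ∧ N.image Prod.snd ∈ S'.faces ∧
    IsChain (· ≤ ·) (N : Set (E × E')) ∧ ∀ x ∈ N, π x.1 = π' x.2}

variable (π : E →ᵃ[ℝ] F) (π' : E' →ᵃ[ℝ] F) (S : SimplicialComplex ℝ E)
    (S' : SimplicialComplex ℝ E')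

/-- The staircase triangulation of a fiber product. -/
def staircaseComplex : SimplicialComplex ℝ (E × E') :=
  .ofWeightUnique (staircaseFaces π π' S S')
    (by
      rintro N ⟨h1, h2, h3, h4⟩
      refine ⟨by simpa using S.nonempty_of_mem_faces h1, fun M hM hne => ⟨?_, ?_, ?_, ?_⟩⟩
      · exact S.down_closed h1 (Finset.image_subset_image hM) (hne.image _)
      · exact S'.down_closed h2 (Finset.image_subset_image hM) (hne.image _)
      · exact h3.mono (by exact_mod_cast hM)
      · exact fun x hx => h4 x (hM hx))
    (by
      rintro w w' hw hw' ⟨h1, h2, h3, -⟩ ⟨h1', h2', h3', -⟩ ht ht' hb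
      refine coupling_unique hw hw' h3 h3' ?_ ?_
      · rw [← support_mapDomain_of_nonneg hw] at h1
        rw [← support_mapDomain_of_nonneg hw'] at h1'
        exact S.weight_unique (mapDomain_nonneg hw _) (mapDomain_nonneg hw' _) h1 h1'
          (by simpa) (by simpa) (by rw [fst_barycenter, fst_barycenter, hb])
      · rw [← support_mapDomain_of_nonneg hw] at h2
        rw [← support_mapDomain_of_nonneg hw'] at h2'
        exact S'.weight_unique (mapDomain_nonneg hw _) (mapDomain_nonneg hw' _) h2 h2'
          (by simpa) (by simpa) (by rw [snd_barycenter, snd_barycenter, hb]))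

theorem mem_staircaseComplex_faces {N : Finset (E × E')} :
    N ∈ (staircaseComplex π π' S S').faces ↔
      N.image Prod.fst ∈ S.faces ∧ N.image Prod.snd ∈ S'.faces ∧
      IsChain (· ≤ ·) (N : Set (E × E')) ∧ ∀ x ∈ N, π x.1 = π' x.2 := Iff.rfl

variable {π π' S S'}

theorem staircaseComplex_faces_finite (hS : S.faces.Finite) (hS' : S'.faces.Finite) :
    (staircaseComplex π π' S S').faces.Finite := by
  refine (((hS.toFinset.biUnion id) ×ˢ (hS'.toFinset.biUnion id)).powerset.finite_toSet).subset
    fun N hN => ?_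
  obtain ⟨h1, h2, -, -⟩ := (mem_staircaseComplex_faces _ _ _ _).1 hN
  simp only [Finset.coe_powerset, Set.mem_preimage, Set.mem_powerset_iff]
  intro x hx
  simp only [Finset.coe_product, Finset.coe_biUnion, id, Set.mem_prod, Set.mem_iUnion]
  exact ⟨⟨_, by simpa using h1, by exact_mod_cast Finset.mem_image_of_mem Prod.fst hx⟩,
    _, by simpa using h2, by exact_mod_cast Finset.mem_image_of_mem Prod.snd hx⟩

theorem staircaseComplex_space [LinearOrder F] (hP : Convex ℝ S.space) (hP' : Convex ℝ S'.space)
    (hπ : Monotone π) (hπ' : Monotone π') {T : SimplicialComplex ℝ F}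
    (hST : ∀ s ∈ S.faces, s.image π ∈ T.faces) (hST' : ∀ s ∈ S'.faces, s.image π' ∈ T.faces) :
    (staircaseComplex π π' S S').space = fiberProduct π π' S.space S'.space := by
  refine Set.Subset.antisymm (fun x hx => ?_) ?_
  · obtain ⟨N, hN, hx⟩ := SimplicialComplex.mem_space_iff.1 hx
    obtain ⟨h1, h2, -, h4⟩ := (mem_staircaseComplex_faces _ _ _ _).1 hN
    refine convexHull_min (fun y hy => ?_) (convex_fiberProduct π π' hP hP') hx
    exact ⟨S.subset_space h1 (by exact_mod_cast Finset.mem_image_of_mem Prod.fst hy),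
      S'.subset_space h2 (by exact_mod_cast Finset.mem_image_of_mem Prod.snd hy), h4 y hy⟩
  · rintro ⟨p, p'⟩ ⟨hp, hp', he⟩
    obtain ⟨u, hu, hus, hut, hub⟩ := S.exists_weight hp
    obtain ⟨v, hv, hvs, hvt, hvb⟩ := S'.exists_weight hp'
    obtain ⟨w, hw, hw1, hw2, hwc⟩ := exists_coupling _ u v hu hv (hut.trans hvt.symm) le_rfl
    have hwt : totalMass w = 1 := by rw [← hut, ← hw1, totalMass_mapDomain]
    -- Both images are weights on faces of `T` with barycenter `π p = π' p'`.
    have hpush : u.mapDomain π = v.mapDomain π' := by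
      refine T.weight_unique (mapDomain_nonneg hu _) (mapDomain_nonneg hv _) ?_ ?_ (by simpa)
        (by simpa) ?_
      · rw [support_mapDomain_of_nonneg hu]; exact hST _ hus
      · rw [support_mapDomain_of_nonneg hv]; exact hST' _ hvs
      · rw [barycenter_mapDomain_affineMap _ hut, barycenter_mapDomain_affineMap _ hvt, hub, hvb]
        exact he
    -- By monotonicity the image of `w` is again supported on a chain, as is the diagonal coupling
    -- with the same marginals. Hence every atom of `w` satisfies the fiber condition.
    have hdiag : w.mapDomain (Prod.map π π') = (u.mapDomain π).mapDomain fun z => (z, z) := by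
      refine coupling_unique (mapDomain_nonneg hw _)
        (mapDomain_nonneg (mapDomain_nonneg hu _) _) ?_ ?_ ?_ ?_
      · rw [support_mapDomain_of_nonneg hw, Finset.coe_image]
        rintro _ ⟨a, ha, rfl⟩ _ ⟨b, hb, rfl⟩ -
        exact (hwc.total ha hb).imp (fun h => ⟨hπ h.1, hπ' h.2⟩) fun h => ⟨hπ h.1, hπ' h.2⟩
      · rw [support_mapDomain_of_nonneg (mapDomain_nonneg hu _), Finset.coe_image]
        rintro _ ⟨a, -, rfl⟩ _ ⟨b, -, rfl⟩ -
        exact (le_total a b).imp (fun h => ⟨h, h⟩) fun h => ⟨h, h⟩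
      · rw [← mapDomain_comp, ← mapDomain_comp, ← hw1, ← mapDomain_comp, ← mapDomain_comp]
        rfl
      · rw [hpush, ← mapDomain_comp, ← mapDomain_comp, ← hw2, ← mapDomain_comp, ← mapDomain_comp]
        rfl
    refine SimplicialComplex.mem_space_iff.2 ⟨w.support, ⟨?_, ?_, hwc, fun x hx => ?_⟩,
      mem_convexHull_finset_iff.2 ⟨w, hw, subset_rfl, hwt, ?_⟩⟩
    · rw [← support_mapDomain_of_nonneg hw, hw1]; exact hus
    · rw [← support_mapDomain_of_nonneg hw, hw2]; exact hvs
    · have : Prod.map π π' x ∈ (w.mapDomain (Prod.map π π')).support := by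
        rw [support_mapDomain_of_nonneg hw]
        exact Finset.mem_image_of_mem _ hx
      rw [hdiag] at this
      obtain ⟨z, -, hz⟩ := Finset.mem_image.1 (mapDomain_support this)
      rw [Prod.ext_iff] at hz
      exact hz.1.symm.trans hz.2
    · exact Prod.ext (by rw [← fst_barycenter, hw1, hub]) (by rw [← snd_barycenter, hw2, hvb])

variable {Λ : AddSubgroup E} {Λ' : AddSubgroup E'} {P : Set E} {P' : Set E'}

theorem staircaseComplex_isUnimodularSimplex (hS : IsUnimodularTriangulation Λ S P)
    (hS' : IsUnimodularTriangulation Λ' S' P') {N : Finset (E × E')}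
    (hN : N ∈ (staircaseComplex π π' S S').faces) : IsUnimodularSimplex (Λ.prod Λ') N := by
  obtain ⟨h1, h2, h3, -⟩ := (mem_staircaseComplex_faces _ _ _ _).1 hN
  have hu := hS.isUnimodularSimplex h1
  have hu' := hS'.isUnimodularSimplex h2
  refine ⟨(staircaseComplex π π' S S').indep hN, fun x hx => ⟨?_, ?_⟩, fun x hxΛ hx => ?_⟩
  · exact hu.2.1 (by exact_mod_cast Finset.mem_image_of_mem Prod.fst hx)
  · exact hu'.2.1 (by exact_mod_cast Finset.mem_image_of_mem Prod.snd hx)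
  · obtain ⟨w, hwN, ht, rfl⟩ := exists_weight_of_mem_affineSpan hx
    have hs1 : (w.mapDomain Prod.fst).support ⊆ N.image Prod.fst :=
      mapDomain_support.trans (Finset.image_subset_image hwN)
    have hs2 : (w.mapDomain Prod.snd).support ⊆ N.image Prod.snd :=
      mapDomain_support.trans (Finset.image_subset_image hwN)
    obtain ⟨c, hc⟩ := hu.exists_int_weight hs1 (by simpa) (by rw [fst_barycenter]; exact hxΛ.1)
    obtain ⟨c', hc'⟩ := hu'.exists_int_weight hs2 (by simpa) (by rw [snd_barycenter]; exact hxΛ.2)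
    have hmem := coupling_apply_mem (Int.castAddHom ℝ).range (w := w)
      (h3.mono (by exact_mod_cast hwN))
      (fun a => by
        by_cases ha : a ∈ N.image Prod.fst
        · exact ⟨c a, (hc a ha).symm⟩
        · rw [notMem_support_iff.1 fun h => ha (hs1 h)]
          exact AddSubgroup.zero_mem _)
      (fun a => by
        by_cases ha : a ∈ N.image Prod.snd
        · exact ⟨c' a, (hc' a ha).symm⟩
        · rw [notMem_support_iff.1 fun h => ha (hs2 h)]
          exact AddSubgroup.zero_mem _)
    choose k hk using hmem
    have hk' : ∀ x, w x = k x := fun x => (hk x).symm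
    refine ⟨k, ?_, ?_⟩
    · rw [totalMass_eq_sum hwN] at ht
      simp only [hk'] at ht
      exact_mod_cast ht
    · rw [barycenter_eq_sum hwN]
      exact Finset.sum_congr rfl fun a _ => by rw [hk' a, Int.cast_smul_eq_zsmul]

/-- The summed heights are tight exactly at the lattice points of the fiber product whose two
coordinates are vertices of the projections of `N`. Among these, `staircaseHeight` singles out `N`.
-/
theorem staircaseComplex_isRegular (hS : IsUnimodularTriangulation Λ S P)
    (hS' : IsUnimodularTriangulation Λ' S' P') (hP : Convex ℝ P) (hP' : Convex ℝ P')
    (hU : IsUnimodularTriangulation (Λ.prod Λ') (staircaseComplex π π' S S')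
      (fiberProduct π π' P P'))
    (hreg : IsRegularTriangulation Λ S) (hreg' : IsRegularTriangulation Λ' S') :
    IsRegularTriangulation (Λ.prod Λ') (staircaseComplex π π' S S') := by
  obtain ⟨ω, hω⟩ := hreg.exists_heights hS
  obtain ⟨ω', hω'⟩ := hreg'.exists_heights hS'
  set V := hS.finite_latticePoints.toFinset with hVdef
  set V' := hS'.finite_latticePoints.toFinset with hVdef'
  refine .of_lex_heights hU (convex_fiberProduct π π' hP hP') (ω := fun x => ω x.1 + ω' x.2)
    (θ := staircaseHeight V V') fun N hN => ?_
  obtain ⟨h1, h2, h3, -⟩ := (mem_staircaseComplex_faces _ _ _ _).1 hN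
  obtain ⟨η, hη, hηs⟩ := hω _ h1
  obtain ⟨η', hη', hηs'⟩ := hω' _ h2
  obtain ⟨f, g, hfg, hfglt⟩ := h3.exists_staircase_potentials (V := V) (V' := V')
    (fun x hx => by
      have := Finset.mem_image_of_mem Prod.fst hx
      simpa [hVdef] using And.intro (S.subset_space h1 this) ((hS.isUnimodularSimplex h1).2.1 this))
    (fun x hx => by
      have := Finset.mem_image_of_mem Prod.snd hx
      simpa [hVdef'] using
        And.intro (S'.subset_space h2 this) ((hS'.isUnimodularSimplex h2).2.1 this))
  obtain ⟨φ, hφ⟩ := (S.indep h1).exists_affineMap_eqOn f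
  obtain ⟨φ', hφ'⟩ := (S'.indep h2).exists_affineMap_eqOn g
  refine ⟨η.comp AffineMap.fst + η'.comp AffineMap.snd,
    φ.comp AffineMap.fst + φ'.comp AffineMap.snd, fun x hx => ?_⟩
  obtain ⟨hxU, hxΛ⟩ := hx
  rw [hU.2.1] at hxU
  have hx1 : x.1 ∈ S.space ∩ Λ := ⟨hS.2.1 ▸ hxU.1, hxΛ.1⟩
  have hx2 : x.2 ∈ S'.space ∩ Λ' := ⟨hS'.2.1 ▸ hxU.2.1, hxΛ.2⟩
  have l1 := hη _ hx1
  have l2 := hη' _ hx2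
  simp only [AffineMap.coe_add, AffineMap.coe_comp, AffineMap.coe_fst, AffineMap.coe_snd,
    Pi.add_apply, Function.comp_apply]
  constructor
  · intro hxN
    have m1 := Finset.mem_image_of_mem Prod.fst hxN
    have m2 := Finset.mem_image_of_mem Prod.snd hxN
    rw [hφ _ m1, hφ' _ m2, (hηs _ hx1).2 m1, (hηs' _ hx2).2 m2]
    exact ⟨rfl, hfg x hxN⟩
  · intro hxN
    by_cases m1 : x.1 ∈ N.image Prod.fst
    · by_cases m2 : x.2 ∈ N.image Prod.snd
      · right
        rw [hφ _ m1, hφ' _ m2, (hηs _ hx1).2 m1, (hηs' _ hx2).2 m2]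
        exact ⟨rfl, hfglt x m1 m2 hxN⟩
      · left
        have := lt_of_le_of_ne l2 fun e => m2 ((hηs' _ hx2).1 e.symm)
        linarith
    · left
      have := lt_of_le_of_ne l1 fun e => m1 ((hηs _ hx1).1 e.symm)
      linarith

theorem staircaseComplex_minimalNonface (hS : IsUnimodularTriangulation Λ S P)
    (hS' : IsUnimodularTriangulation Λ' S' P')
    (hU : IsUnimodularTriangulation (Λ.prod Λ') (staircaseComplex π π' S S')
      (fiberProduct π π' P P')) {N : Finset (E × E')}
    (hN : IsMinimalNonface (Λ.prod Λ') (staircaseComplex π π' S S') N) :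
    N.card = 2 ∨ (∃ M : Finset E, IsMinimalNonface Λ S M ∧ M.card = N.card) ∨
      ∃ M : Finset E', IsMinimalNonface Λ' S' M ∧ M.card = N.card := by
  have hmem : ∀ x ∈ N, x ∈ fiberProduct π π' P P' ∧ x ∈ Λ.prod Λ' := fun x hx => by
    have := hN.2.1 hx
    rwa [hU.2.1] at this
  have h1 : N.card ≠ 1 := by
    intro h
    obtain ⟨x, rfl⟩ := Finset.card_eq_one.1 h
    exact hN.2.2.1 (hU.singleton_mem (hN.2.1 (by simp)).1 (hN.2.1 (by simp)).2)
  have h0 := hN.1.card_pos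
  by_cases h2 : N.card = 2
  · exact Or.inl h2
  right
  -- With more than two elements in `N`, each pair is a proper subset, hence a face and thus
  -- comparable.
  have hchain : IsChain (· ≤ ·) (N : Set (E × E')) := by
    intro x hx y hy hxy
    have hsub : ({x, y} : Finset (E × E')) ⊂ N := by
      refine Finset.ssubset_iff_subset_ne.2 ⟨by simp [Finset.insert_subset_iff, *] at *; simp [*],
        fun e => h2 ?_⟩
      rw [← e, Finset.card_pair hxy]
    exact (hN.2.2.2 _ hsub (by simp)).2.2.1 (by simp) (by simp) hxy
  by_cases hf : N.image Prod.fst ∈ S.faces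
  · right
    refine exists_minimalNonface_card_of_image hN Prod.snd (fun s hs => hs.2.1)
      (fun x hx => ⟨hS'.2.1 ▸ (hmem x hx).1.2.1, (hmem x hx).2.2⟩) fun hs => ?_
    exact hN.2.2.1 ⟨hf, hs, hchain, fun x hx => (hmem x hx).1.2.2⟩
  · left
    exact exists_minimalNonface_card_of_image hN Prod.fst (fun s hs => hs.1)
      (fun x hx => ⟨hS.2.1 ▸ (hmem x hx).1.1, (hmem x hx).2.1⟩) hf

end FiberProduct

/-! ### Choice of orders and conclusion. -/

/-- Any order on `γ` works: points are compared by their images first, and ties are broken by an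
arbitrary order on the source. -/
theorem exists_monotone_linearOrders {α β γ : Type*} (f : α → γ) (g : β → γ) :
    ∃ (_ : LinearOrder α) (_ : LinearOrder β) (_ : LinearOrder γ), Monotone f ∧ Monotone g := by
  classical
  let oα : LinearOrder α := linearOrderOfSTO WellOrderingRel
  let oβ : LinearOrder β := linearOrderOfSTO WellOrderingRel
  let oγ : LinearOrder γ := linearOrderOfSTO WellOrderingRel
  refine ⟨LinearOrder.lift' (fun a => toLex (f a, a)) fun a b h => ?_,
    LinearOrder.lift' (fun a => toLex (g a, a)) fun a b h => ?_, oγ, fun a b h => ?_,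
    fun a b h => ?_⟩
  · exact (Prod.ext_iff.1 (toLex.injective h)).2
  · exact (Prod.ext_iff.1 (toLex.injective h)).2
  · change toLex (f a, a) ≤ toLex (f b, b) at h
    rw [Prod.Lex.toLex_le_toLex] at h
    exact h.elim le_of_lt fun h => h.1.le
  · change toLex (g a, a) ≤ toLex (g b, b) at h
    rw [Prod.Lex.toLex_le_toLex] at h
    exact h.elim le_of_lt fun h => h.1.le

theorem exists_fiberProduct_triangulation {E E' F : Type*} [AddCommGroup E] [Module ℝ E]
    [AddCommGroup E'] [Module ℝ E'] [AddCommGroup F] [Module ℝ F]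
    {Λ : AddSubgroup E} {Λ' : AddSubgroup E'} {M : AddSubgroup F}
    {P : Set E} {P' : Set E'} {Q : Set F} (hP : Convex ℝ P) (hP' : Convex ℝ P')
    {π : E →ᵃ[ℝ] F} {π' : E' →ᵃ[ℝ] F}
    (hπ : IsLatticeProjection Λ M π P Q) (hπ' : IsLatticeProjection Λ' M π' P' Q)
    {T : Geometry.SimplicialComplex ℝ F} {S : Geometry.SimplicialComplex ℝ E}
    {S' : Geometry.SimplicialComplex ℝ E'}
    (hT : IsUnimodularTriangulation M T Q) (hS : IsUnimodularTriangulation Λ S P)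
    (hS' : IsUnimodularTriangulation Λ' S' P') (hST : Refines S (pullBackCells π P T))
    (hST' : Refines S' (pullBackCells π' P' T)) :
    ∃ U : Geometry.SimplicialComplex ℝ (E × E'),
      IsUnimodularTriangulation (Λ.prod Λ') U (fiberProduct π π' P P') ∧
      (IsRegularTriangulation Λ S → IsRegularTriangulation Λ' S' →
        IsRegularTriangulation (Λ.prod Λ') U) ∧
      ∀ N : Finset (E × E'), IsMinimalNonface (Λ.prod Λ') U N →
        N.card = 2 ∨ (∃ M : Finset E, IsMinimalNonface Λ S M ∧ M.card = N.card) ∨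
          ∃ M' : Finset E', IsMinimalNonface Λ' S' M' ∧ M'.card = N.card := by
  obtain ⟨_, _, _, hm, hm'⟩ := exists_monotone_linearOrders π π'
  have hU : IsUnimodularTriangulation (Λ.prod Λ') (staircaseComplex π π' S S')
      (fiberProduct π π' P P') := by
    refine ⟨staircaseComplex_faces_finite hS.1 hS'.1, ?_,
      fun N hN => staircaseComplex_isUnimodularSimplex hS hS' hN.1⟩
    have := staircaseComplex_space (S := S) (S' := S') (hS.2.1 ▸ hP) (hS'.2.1 ▸ hP') hm hm'
      (fun s hs => hST.image_mem_faces hπ hS hT hs)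
      (fun s hs => hST'.image_mem_faces hπ' hS' hT hs)
    rwa [hS.2.1, hS'.2.1] at this
  exact ⟨_, hU, staircaseComplex_isRegular hS hS' hP hP' hU,
    fun N hN => staircaseComplex_minimalNonface hS hS' hU hN⟩

theorem mainTheorem9 {d d' e : ℕ}
    (P : Set (Fin d → ℝ)) (P' : Set (Fin d' → ℝ)) (Q : Set (Fin e → ℝ))
    (hP : IsLatticePolytope (intLattice d) P)
    (hP' : IsLatticePolytope (intLattice d') P')
    (hQ : IsLatticePolytope (intLattice e) Q)
    (π : (Fin d → ℝ) →ᵃ[ℝ] (Fin e → ℝ)) (π' : (Fin d' → ℝ) →ᵃ[ℝ] (Fin e → ℝ))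
    (hπ : IsLatticeProjection (intLattice d) (intLattice e) π P Q)
    (hπ' : IsLatticeProjection (intLattice d') (intLattice e) π' P' Q)
    (T : Geometry.SimplicialComplex ℝ (Fin e → ℝ))
    (S : Geometry.SimplicialComplex ℝ (Fin d → ℝ))
    (S' : Geometry.SimplicialComplex ℝ (Fin d' → ℝ))
    (hT : IsUnimodularTriangulation (intLattice e) T Q)
    (hS : IsUnimodularTriangulation (intLattice d) S P)
    (hS' : IsUnimodularTriangulation (intLattice d') S' P')
    (hST : Refines S (pullBackCells π P T))
    (hST' : Refines S' (pullBackCells π' P' T)) :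
    IsLatticePolytope ((intLattice d).prod (intLattice d')) (fiberProduct π π' P P') ∧
    ∃ U : Geometry.SimplicialComplex ℝ ((Fin d → ℝ) × (Fin d' → ℝ)),
      IsUnimodularTriangulation ((intLattice d).prod (intLattice d')) U
        (fiberProduct π π' P P') ∧
      (IsRegularTriangulation (intLattice d) S → IsRegularTriangulation (intLattice d') S' →
        IsRegularTriangulation ((intLattice d).prod (intLattice d')) U) ∧
      ∀ N : Finset ((Fin d → ℝ) × (Fin d' → ℝ)),
        IsMinimalNonface ((intLattice d).prod (intLattice d')) U N →
          N.card = 2 ∨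
          (∃ M : Finset (Fin d → ℝ), IsMinimalNonface (intLattice d) S M ∧ M.card = N.card) ∨
          (∃ M' : Finset (Fin d' → ℝ),
            IsMinimalNonface (intLattice d') S' M' ∧ M'.card = N.card) := by

  have hconv : Convex ℝ P := by
    obtain ⟨V, -, rfl⟩ := hP
    exact convex_convexHull ℝ _
  have hconv' : Convex ℝ P' := by
    obtain ⟨V, -, rfl⟩ := hP'
    exact convex_convexHull ℝ _
  obtain ⟨U, hU, hU'⟩ :=
    exists_fiberProduct_triangulation hconv hconv' hπ hπ' hT hS hS' hST hST'
  exact ⟨isLatticePolytope_of_triangulation hU (convex_fiberProduct π π' hconv hconv'), U, hU, hU'⟩
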